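/- Let $B_0,\dots,B_m\in\mathfrak{so}(n)$ be real antisymmetric $n\times n$ matrices and let $\mathfrak h=\mathrm{Lie}\{B_0,\dots,B_m\}\le\mathfrak{so}(n)$ be the Lie algebra they generate under the commutator. Let $H\le \mathrm{SO}(n)$ be a closed subgroup whose Lie algebra $\{A\in\mathbb R^{n\times n}:\exp(tA)\in H\text{ for all }t\in\mathbb R\}$ equals $\mathfrak h$, and let $x\in\mathbb S^{n-1}\subset\mathbb R^n$, with orbit $H(x)=\{gx: g\in H\}$. Then $H(x)$ is a smooth embedded submanifold, of some dimension $\dim H(x)$, and $$\operatorname{rank}_y\mathfrak h:=\dim\{Ay: A\in\mathfrak h\}=\dim H(x)\qquad\text{for every } y\in H(x).$$ Consequently, let $\mathfrak L=\mathrm{Lie}\{B_0x,\dots,B_mx\}$ be the Lie algebra of vector fields on $\mathbb R^n$ generated by the linear vector fields $x\mapsto B_ix$ (which are tangent to $\mathbb S^{n-1}$) under the Lie bracket of vector fields. Its rank $\dim\{V(y):V\in\mathfrak L\}$ at $y$ is constant for $y\in H(x)$, and equals $\dim H(x)$. -/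

import Mathlib

open scoped ContDiff

-- Matrices form a Lie algebra under the commutator `[C, D] = C D - D C`.
attribute [local instance 100] LieRing.ofAssociativeRing

noncomputable section

namespace OrbitRank

/-- `ℝⁿ` with its Euclidean norm. -/
abbrev E (n : ℕ) : Type := EuclideanSpace ℝ (Fin n)

/-- Real `n × n` matrices. -/
abbrev Mat (n : ℕ) : Type := Matrix (Fin n) (Fin n) ℝ

/-- The evaluation map `A ↦ A y` at a point `y` of `ℝⁿ`. -/
def evalAt {n : ℕ} (y : E n) : Mat n →ₗ[ℝ] E n :=
  LinearMap.applyₗ y ∘ₗ (Matrix.toEuclideanLin (𝕜 := ℝ) (m := Fin n) (n := Fin n)).toLinearMap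

/-- The rank at `y` of a Lie algebra `𝔤` of matrices: `dim {A y : A ∈ 𝔤}`. -/
def rankAt {n : ℕ} (𝔤 : LieSubalgebra ℝ (Mat n)) (y : E n) : ℕ :=
  Module.finrank ℝ (𝔤.toSubmodule.map (evalAt y))

/-- The Lie algebra of a closed subgroup `H` of `SO(n)`, as a set of matrices:
all `A` whose one-parameter group `exp (t A)` lies in `H`. -/
def lieAlgebraOf {n : ℕ} (H : Subgroup (Matrix.specialOrthogonalGroup (Fin n) ℝ)) :
    Set (Mat n) :=
  {A | ∀ t : ℝ, ∃ g ∈ H, (g : Mat n) = NormedSpace.exp (t • A)}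

/-- The orbit `H(x)` for the natural action of `H ≤ SO(n)` on `ℝⁿ`. -/
def orbit {n : ℕ} (H : Subgroup (Matrix.specialOrthogonalGroup (Fin n) ℝ)) (x : E n) :
    Set (E n) :=
  {y | ∃ g ∈ H, Matrix.toEuclideanLin (g : Mat n) x = y}

/-- `S ⊆ ℝⁿ` is a smooth embedded submanifold of dimension `d`: around each of its points there
is a smooth chart of the ambient space (a diffeomorphism between open sets) that flattens `S` to a
`d`-dimensional linear subspace. -/
def IsEmbeddedSubmanifold {n : ℕ} (d : ℕ) (S : Set (E n)) : Prop :=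
  ∀ p ∈ S, ∃ (φ : OpenPartialHomeomorph (E n) (E n)) (W : Submodule ℝ (E n)),
    p ∈ φ.source ∧ ContDiffOn ℝ ∞ φ φ.source ∧ ContDiffOn ℝ ∞ φ.symm φ.target ∧
    Module.finrank ℝ W = d ∧ φ '' (φ.source ∩ S) = φ.target ∩ (W : Set (E n))

/-- The linear vector field `x ↦ B x`. -/
def linearField {n : ℕ} (B : Mat n) : E n → E n :=
  fun x => Matrix.toEuclideanLin B x

/-- The Lie algebra of vector fields on `ℝⁿ` generated by a set `F` of smooth vector fields: the
smallest real vector space of vector fields that contains `F` and is closed under the Lie bracket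
of vector fields. (Smooth fields form such a space, so every member is smooth when `F` is.) -/
def fieldLieSpan {n : ℕ} (F : Set (E n → E n)) : Submodule ℝ (E n → E n) :=
  sInf {L | F ⊆ L ∧ ∀ V ∈ L, ∀ W ∈ L, VectorField.lieBracket ℝ V W ∈ L}

/-- The rank at `y` of a space of vector fields: `dim {V y : V ∈ L}`. -/
def fieldRankAt {n : ℕ} (L : Submodule ℝ (E n → E n)) (y : E n) : ℕ :=
  Module.finrank ℝ (L.map (LinearMap.proj (R := ℝ) (φ := fun _ : E n => E n) y))

end OrbitRank

end

/-!
If `𝔤` is the Lie algebra of `G`, then `g 𝔤 g⁻¹ = 𝔤` for `g ∈ G`, so `g` maps `𝔤 x` onto `𝔤 (g x)`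
and the rank is constant along the orbit. It remains to see that the orbit of a compact group is
flattened near `x` onto `𝔤 x` by a chart.

Let `S` be a complement of `𝔤`. As in Cartan's closed subgroup theorem, no small nonzero `a ∈ S`
has `exp a ∈ G`: otherwise the directions `a / ‖a‖` of such `a → 0` would accumulate at a
one-parameter subgroup of `G` whose generator lies in `S`. Let `σ : 𝔤 x → 𝔤` be a linear section of
`a ↦ a x`, and put `P a = σ (a x)`. By the inverse function theorem every `g` near `1` is a product
`exp (P a) exp (a - P a) exp s` with `a ∈ 𝔤` and `s ∈ S`. If `g ∈ G` then `s = 0`, while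
`exp (a - P a)` fixes `x` because `(a - P a) x = 0`, so `g x = exp (σ t) x` with `t = a x`.
Since `g ↦ g x` is a closed map for compact `G`, all points of the orbit close to `x` are `g x` with
`g` close to `1`. So near `x` the orbit is `{exp (σ t) x : t ∈ 𝔤 x}`, and extending
`t ↦ exp (σ t) x` to a local diffeomorphism of the ambient space gives the chart.

The bracket of two linear vector fields is the linear field of the commutator of their matrices in
the opposite order, so the fields generated by the `B i` are the linear fields of `Lie {B i}`.
-/

namespace OrbitRank

open Filter Topology NormedSpace

section CompactAction

variable {G X : Type*} [Group G] [TopologicalSpace G] [SeparatelyContinuousMul G] [CompactSpace G]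
  [TopologicalSpace X] [T2Space X] [MulAction G X] {x : X}

theorem eventually_mem_orbit_imp_exists_smul_eq (hx : Continuous fun g : G => g • x) {U : Set G}
    (hU : U ∈ 𝓝 1) : ∀ᶠ y in 𝓝 x, y ∈ MulAction.orbit G x → ∃ g ∈ U, g • x = y := by
  have near_fiber : ∀ g ∈ (fun g : G => g • x) ⁻¹' {x}, ∀ᶠ k in 𝓝 g, k * g⁻¹ ∈ U := fun g _ =>
    (continuous_mul_const g⁻¹).tendsto' g 1 (mul_inv_cancel g) |>.eventually hU
  have near_stabilizer : ∀ g ∈ (fun g : G => g • x) ⁻¹' {x},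
      ∀ᶠ k in 𝓝 g, ∃ s ∈ MulAction.stabilizer G x, k * s ∈ U := fun g hg =>
    (near_fiber g hg).mono fun k hk =>
      ⟨g⁻¹, (MulAction.stabilizer G x).inv_mem (MulAction.mem_stabilizer_iff.2 hg), hk⟩
  filter_upwards [hx.isClosedMap.eventually_nhds_fiber x near_stabilizer] with y hy
  rintro ⟨g, rfl⟩
  obtain ⟨s, hs, hgs⟩ := hy g rfl
  exact ⟨g * s, hgs, by rw [mul_smul, MulAction.mem_stabilizer_iff.1 hs]⟩

end CompactAction

section LinearSection

theorem exists_section_on_map {K V W : Type*} [Field K] [AddCommGroup V] [Module K V]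
    [AddCommGroup W] [Module K W] (f : V →ₗ[K] W) (S : Submodule K V) :
    ∃ σ : W →ₗ[K] S, ∀ w ∈ S.map f, f (σ w) = w := by
  obtain ⟨g, hg⟩ := (f.submoduleMap S).exists_rightInverse_of_surjective
    (LinearMap.range_eq_top.2 (f.submoduleMap_surjective S))
  obtain ⟨σ, hσ⟩ := g.exists_extend
  refine ⟨σ, fun w hw => ?_⟩
  have hσw : σ w = g ⟨w, hw⟩ := LinearMap.congr_fun hσ ⟨w, hw⟩
  rw [hσw]
  exact congrArg Subtype.val (LinearMap.congr_fun hg ⟨w, hw⟩)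

end LinearSection

section Flattening

variable {𝕜 V W : Type*} [RCLike 𝕜] [NormedAddCommGroup V] [NormedSpace 𝕜 V] [CompleteSpace V]
  [NormedAddCommGroup W] [NormedSpace 𝕜 W] {k : ℕ∞ω}

theorem exists_flattening_chart {f : V → W} {f' : V ≃L[𝕜] W} {a : V} (hk : k ≠ 0) (hk' : k ≠ ∞)
    (hf : ContDiff 𝕜 k f) (hf' : HasFDerivAt f (f' : V →L[𝕜] W) a) {T : Set V} {S : Set W}
    (hTS : Set.MapsTo f T S)
    (hST : ∀ U ∈ 𝓝 a, ∀ᶠ y in 𝓝 (f a), y ∈ S → ∃ t ∈ T ∩ U, f t = y) :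
    ∃ φ : OpenPartialHomeomorph W V, f a ∈ φ.source ∧ ContDiffOn 𝕜 k φ φ.source ∧
      ContDiffOn 𝕜 k φ.symm φ.target ∧ φ '' (φ.source ∩ S) = φ.target ∩ T := by
  let e := hf.contDiffAt.toOpenPartialHomeomorph f hf' hk
  have ha : a ∈ e.source := hf.contDiffAt.mem_toOpenPartialHomeomorph_source hf' hk
  have hfa : f a ∈ e.target := hf.contDiffAt.image_mem_toOpenPartialHomeomorph_target hf' hk
  have hsymm : ContDiffAt 𝕜 k e.symm (f a) := hf.contDiffAt.to_localInverse hf' hk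
  obtain ⟨O, hO, hO_open, haO⟩ := eventually_nhds_iff.1
    ((hsymm.eventually hk').and (hST e.source (e.open_source.mem_nhds ha)))
  let φ := e.symm.restrOpen O hO_open
  refine ⟨φ, ⟨hfa, haO⟩, fun y hy => (hO y hy.2).1.contDiffWithinAt, hf.contDiffOn,
    Set.Subset.antisymm ?_ ?_⟩
  · rintro _ ⟨y, ⟨hy, hyS⟩, rfl⟩
    obtain ⟨t, ⟨htT, ht⟩, rfl⟩ := (hO y hy.2).2 hyS
    refine ⟨φ.map_source hy, ?_⟩
    rwa [show φ (f t) = t from e.left_inv ht]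
  · rintro t ⟨ht, htT⟩
    exact ⟨f t, ⟨φ.map_target ht, hTS htT⟩, φ.right_inv ht⟩

end Flattening

section Exponential

variable {𝔸 : Type*} [NormedRing 𝔸] [NormedAlgebra ℝ 𝔸] [CompleteSpace 𝔸]

/-- The exponential of a complete normed algebra, as a map into the group of units. -/
noncomputable def expUnit (a : 𝔸) : 𝔸ˣ :=
  letI := NormedAlgebra.restrictScalars ℚ ℝ 𝔸
  { val := exp a
    inv := exp (-a)
    val_inv := by
      rw [← exp_add_of_commute (Commute.neg_right (Commute.refl a)), add_neg_cancel, exp_zero]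
    inv_val := by
      rw [← exp_add_of_commute (Commute.neg_left (Commute.refl a)), neg_add_cancel, exp_zero] }

@[simp]
theorem expUnit_zero : expUnit (0 : 𝔸) = 1 := Units.ext exp_zero

theorem expUnit_neg (a : 𝔸) : expUnit (-a) = (expUnit a)⁻¹ := Units.ext rfl

theorem expUnit_nsmul (k : ℕ) (a : 𝔸) : expUnit (k • a) = expUnit a ^ k :=
  letI := NormedAlgebra.restrictScalars ℚ ℝ 𝔸
  Units.ext (exp_nsmul k a)

theorem expUnit_conj (g : 𝔸ˣ) (a : 𝔸) : expUnit (g * a * ↑g⁻¹) = g * expUnit a * g⁻¹ :=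
  letI := NormedAlgebra.restrictScalars ℚ ℝ 𝔸
  Units.ext (exp_units_conj g a)

theorem continuous_expUnit : Continuous (expUnit : 𝔸 → 𝔸ˣ) :=
  letI := NormedAlgebra.restrictScalars ℚ ℝ 𝔸
  Units.continuous_iff.2 ⟨exp_continuous, exp_continuous.comp continuous_neg⟩

theorem hasStrictFDerivAt_exp_comp_zero (L : 𝔸 →L[ℝ] 𝔸) :
    HasStrictFDerivAt (fun a => exp (L a)) L 0 := by
  have hexp : HasStrictFDerivAt (exp : 𝔸 → 𝔸) (1 : 𝔸 →L[ℝ] 𝔸) (L 0) := by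
    rw [map_zero]
    exact hasStrictFDerivAt_exp_zero
  exact hexp.comp 0 L.hasStrictFDerivAt

theorem map_expUnit_mul_expUnit_mul_expUnit_nhds_zero (L₁ L₂ L₃ : 𝔸 →L[ℝ] 𝔸)
    (h : ∀ a, L₁ a + L₂ a + L₃ a = a) :
    map (fun a => expUnit (L₁ a) * expUnit (L₂ a) * expUnit (L₃ a)) (𝓝 0) = 𝓝 1 := by
  have hderiv := (((hasStrictFDerivAt_exp_comp_zero L₁).mul'
    (hasStrictFDerivAt_exp_comp_zero L₂)).mul' (hasStrictFDerivAt_exp_comp_zero L₃)).congr_fderiv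
    (g' := (ContinuousLinearEquiv.refl ℝ 𝔸 : 𝔸 →L[ℝ] 𝔸)) (by
      ext1 a
      simp only [Pi.mul_apply, map_zero, exp_zero, mul_one, one_smul, MulOpposite.op_one,
        add_apply, ContinuousLinearEquiv.coe_coe, ContinuousLinearEquiv.refl_apply]
      calc
        _ = L₁ a + L₂ a + L₃ a := by abel
        _ = a := h a)
  have hmap := HasStrictFDerivAt.map_nhds_eq_of_equiv hderiv
  simp only [Pi.mul_apply, map_zero, exp_zero, mul_one] at hmap
  refine Filter.map_injective Units.val_injective ?_
  rw [Filter.map_map, Units.isOpenEmbedding_val.map_nhds_eq]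
  exact hmap

end Exponential

section LieAlgebra

/-- The Lie algebra of a group `G` of units of a topological algebra: the elements whose
one-parameter group lies in `G`. -/
def lieAlgebra {𝔸 : Type*} [Ring 𝔸] [Algebra ℝ 𝔸] [TopologicalSpace 𝔸] [IsTopologicalRing 𝔸]
    (G : Subgroup 𝔸ˣ) : Set 𝔸 :=
  {a | ∀ t : ℝ, ∃ g ∈ G, (g : 𝔸) = exp (t • a)}

variable {𝔸 : Type*} [NormedRing 𝔸] [NormedAlgebra ℝ 𝔸] [CompleteSpace 𝔸] {G : Subgroup 𝔸ˣ}

theorem mem_lieAlgebra {a : 𝔸} : a ∈ lieAlgebra G ↔ ∀ t : ℝ, expUnit (t • a) ∈ G := by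
  refine forall_congr' fun t => ⟨?_, fun h => ⟨_, h, rfl⟩⟩
  rintro ⟨g, hg, hgt⟩
  rwa [← show g = expUnit (t • a) from Units.ext hgt]

theorem expUnit_mem {a : 𝔸} (ha : a ∈ lieAlgebra G) : expUnit a ∈ G := by
  simpa only [one_smul] using mem_lieAlgebra.1 ha 1

theorem mem_lieAlgebra_of_nonneg {a : 𝔸} (ha : ∀ t : ℝ, 0 ≤ t → expUnit (t • a) ∈ G) :
    a ∈ lieAlgebra G := by
  refine mem_lieAlgebra.2 fun t => ?_
  rcases le_total 0 t with ht | ht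
  · exact ha t ht
  · rw [← G.inv_mem_iff, ← expUnit_neg, ← neg_smul]
    exact ha (-t) (neg_nonneg.2 ht)

theorem conj_mem_lieAlgebra {g : 𝔸ˣ} (hg : g ∈ G) {a : 𝔸} (ha : a ∈ lieAlgebra G) :
    g * a * ↑g⁻¹ ∈ lieAlgebra G := by
  refine mem_lieAlgebra.2 fun t => ?_
  rw [← smul_mul_assoc, ← mul_smul_comm, expUnit_conj]
  exact G.mul_mem (G.mul_mem hg (mem_lieAlgebra.1 ha t)) (G.inv_mem hg)

theorem mem_lieAlgebra_of_tendsto_smul (hG : IsClosed (G : Set 𝔸ˣ)) {ι : Type*} {l : Filter ι}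
    [l.NeBot] {c : ι → ℝ} {u : ι → 𝔸} {a : 𝔸} (hc : Tendsto c l atTop)
    (hu : ∀ i, expUnit (u i) ∈ G) (ha : Tendsto (fun i => c i • u i) l (𝓝 a)) :
    a ∈ lieAlgebra G := by
  refine mem_lieAlgebra_of_nonneg fun t ht => ?_
  have multiples_tendsto : Tendsto (fun i => ⌊t * c i⌋₊ • u i) l (𝓝 (t • a)) := by
    refine (((tendsto_nat_floor_mul_div_atTop ht).comp hc).smul ha).congr' ?_
    filter_upwards [hc.eventually_ne_atTop 0] with i hi
    rw [Function.comp_apply, smul_smul, div_mul_cancel₀ _ hi, Nat.cast_smul_eq_nsmul]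
  refine hG.mem_of_tendsto ((continuous_expUnit.tendsto _).comp multiples_tendsto)
    (Eventually.of_forall fun i => ?_)
  rw [Function.comp_apply, expUnit_nsmul]
  exact G.pow_mem (hu i) _

end LieAlgebra

section ClosedSubgroup

variable {𝔸 : Type*} [NormedRing 𝔸] [NormedAlgebra ℝ 𝔸] [FiniteDimensional ℝ 𝔸] {G : Subgroup 𝔸ˣ}
  {𝔤 : Submodule ℝ 𝔸}

theorem eventually_expUnit_mem_imp_eq_zero (hG : IsClosed (G : Set 𝔸ˣ)) {S : Submodule ℝ 𝔸}
    (hS : ∀ a ∈ S, a ∈ lieAlgebra G → a = 0) :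
    ∀ᶠ a in 𝓝 (0 : 𝔸), a ∈ S → expUnit a ∈ G → a = 0 := by
  by_contra hcon
  have hfreq : ∃ᶠ a in 𝓝 (0 : 𝔸), a ∈ S ∧ expUnit a ∈ G ∧ a ≠ 0 :=
    (not_eventually.1 hcon).mono fun a ha => by push Not at ha; exact ha
  obtain ⟨u, hu_lim, hu⟩ := exists_seq_forall_of_frequently hfreq
  have hu_sphere : ∀ k, ‖u k‖⁻¹ • u k ∈ Metric.sphere (0 : 𝔸) 1 := fun k => by
    rw [mem_sphere_zero_iff_norm, norm_smul, norm_inv, norm_norm,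
      inv_mul_cancel₀ (norm_ne_zero_iff.2 (hu k).2.2)]
  obtain ⟨a, ha, φ, hφ, hlim⟩ := (isCompact_sphere (0 : 𝔸) 1).tendsto_subseq hu_sphere
  have haS : a ∈ S := S.closed_of_finiteDimensional.mem_of_tendsto hlim
    (Eventually.of_forall fun k => S.smul_mem _ (hu (φ k)).1)
  have hnorm_inv : Tendsto (fun k => ‖u k‖⁻¹) atTop atTop :=
    tendsto_inv_nhdsGT_zero.comp (tendsto_nhdsWithin_iff.2
      ⟨tendsto_norm_zero.comp hu_lim, Eventually.of_forall fun k => norm_pos_iff.2 (hu k).2.2⟩)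
  have haG : a ∈ lieAlgebra G := mem_lieAlgebra_of_tendsto_smul hG
    (hnorm_inv.comp hφ.tendsto_atTop) (fun k => (hu (φ k)).2.1) hlim
  rw [mem_sphere_zero_iff_norm, hS a haS haG, norm_zero] at ha
  exact zero_ne_one ha

theorem eventually_mem_imp_exists_expUnit_mul_expUnit_eq (hG : IsClosed (G : Set 𝔸ˣ))
    (h𝔤 : lieAlgebra G = (𝔤 : Set 𝔸)) {P : 𝔸 →ₗ[ℝ] 𝔸} (hP : ∀ a ∈ 𝔤, P a ∈ 𝔤) {U : Set 𝔸}
    (hU : U ∈ 𝓝 0) :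
    ∀ᶠ g in 𝓝 (1 : 𝔸ˣ), g ∈ G → ∃ a ∈ (𝔤 : Set 𝔸) ∩ U, expUnit (P a) * expUnit (a - P a) = g := by
  obtain ⟨S, hS⟩ := 𝔤.exists_isCompl
  let q : 𝔸 →L[ℝ] 𝔸 := (𝔤.projection S hS).toContinuousLinearMap
  let p : 𝔸 →L[ℝ] 𝔸 := P.toContinuousLinearMap
  let r : 𝔸 →L[ℝ] 𝔸 := .id ℝ 𝔸 - q
  have hq : ∀ a, q a ∈ 𝔤 := 𝔤.projection_apply_mem hS
  have hr : ∀ a, r a ∈ S := fun a => by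
    rw [← 𝔤.projection_apply_eq_zero_iff hS]
    change q (a - q a) = 0
    rw [map_sub, sub_eq_zero]
    exact (𝔤.projection_apply_of_mem_left hS (hq a)).symm
  have hexp : ∀ a ∈ 𝔤, expUnit a ∈ G := fun a ha => expUnit_mem (h𝔤.symm ▸ ha)
  have hS_small := eventually_expUnit_mem_imp_eq_zero hG fun a haS ha =>
    (Submodule.disjoint_def.1 hS.disjoint) a (h𝔤.subset ha) haS
  rw [← map_expUnit_mul_expUnit_mul_expUnit_nhds_zero (p ∘L q) (q - p ∘L q) r fun a => by
    simp [r], eventually_map]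
  filter_upwards [r.continuous.tendsto' 0 0 (map_zero r) |>.eventually hS_small,
    q.continuous.tendsto' 0 0 (map_zero q) |>.eventually hU] with a hra hqa ha
  have hr_exp : expUnit (r a) ∈ G :=
    (G.mul_mem_cancel_left (G.mul_mem (hexp _ (hP _ (hq a)))
      (hexp _ (𝔤.sub_mem (hq a) (hP _ (hq a)))))).1 ha
  refine ⟨q a, ⟨hq a, hqa⟩, ?_⟩
  rw [hra (hr a) hr_exp, expUnit_zero, mul_one]
  rfl

end ClosedSubgroup

section TangentSpace

/-- The space `𝔤 x` of velocities at `x` of the linear action of the elements of `𝔤`. -/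
def tangentSpace {𝔸 V : Type*} [Ring 𝔸] [Algebra ℝ 𝔸] [AddCommGroup V] [Module ℝ V] [Module 𝔸 V]
    [IsScalarTower ℝ 𝔸 V] (𝔤 : Submodule ℝ 𝔸) (x : V) : Submodule ℝ V :=
  𝔤.map ((LinearMap.toSpanSingleton 𝔸 V x).restrictScalars ℝ)

variable {𝔸 V : Type*} [NormedRing 𝔸] [NormedAlgebra ℝ 𝔸] [CompleteSpace 𝔸] [AddCommGroup V]
  [Module ℝ V] [Module 𝔸 V] [IsScalarTower ℝ 𝔸 V] {G : Subgroup 𝔸ˣ} {𝔤 : Submodule ℝ 𝔸}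

theorem map_tangentSpace_le_tangentSpace_smul (h𝔤 : lieAlgebra G = (𝔤 : Set 𝔸)) {g : 𝔸ˣ}
    (hg : g ∈ G) (x : V) :
    (tangentSpace 𝔤 x).map (DistribMulAction.toLinearEquiv ℝ V g : V →ₗ[ℝ] V) ≤
      tangentSpace 𝔤 (g • x) := by
  rintro _ ⟨_, ⟨a, ha, rfl⟩, rfl⟩
  have hconj : g * a * ↑g⁻¹ ∈ 𝔤 := h𝔤.subset (conj_mem_lieAlgebra hg (h𝔤.symm.subset ha))
  refine ⟨_, hconj, ?_⟩
  change (g * a * ↑g⁻¹ : 𝔸) • (g : 𝔸) • x = (g : 𝔸) • a • x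
  rw [smul_smul, smul_smul, mul_assoc, Units.inv_mul, mul_one]

theorem finrank_tangentSpace_le_smul [FiniteDimensional ℝ 𝔤] (h𝔤 : lieAlgebra G = (𝔤 : Set 𝔸))
    {g : 𝔸ˣ} (hg : g ∈ G) (x : V) :
    Module.finrank ℝ (tangentSpace 𝔤 x) ≤ Module.finrank ℝ (tangentSpace 𝔤 (g • x)) := by
  have : FiniteDimensional ℝ (tangentSpace 𝔤 (g • x)) := Module.Finite.map 𝔤 _
  rw [← LinearEquiv.finrank_map_eq (DistribMulAction.toLinearEquiv ℝ V g)]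
  exact Submodule.finrank_mono (map_tangentSpace_le_tangentSpace_smul h𝔤 hg x)

theorem finrank_tangentSpace_eq_of_mem_orbit [FiniteDimensional ℝ 𝔤]
    (h𝔤 : lieAlgebra G = (𝔤 : Set 𝔸)) {x y : V} (hy : y ∈ MulAction.orbit G x) :
    Module.finrank ℝ (tangentSpace 𝔤 y) = Module.finrank ℝ (tangentSpace 𝔤 x) := by
  obtain ⟨g, rfl⟩ := hy
  refine le_antisymm ?_ (finrank_tangentSpace_le_smul h𝔤 g.2 x)
  have := finrank_tangentSpace_le_smul h𝔤 (G.inv_mem g.2) (g • x)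
  rwa [show (g : 𝔸ˣ)⁻¹ • g • x = x from inv_smul_smul g x] at this

end TangentSpace

section Slice

variable {𝔸 V : Type*} [NormedRing 𝔸] [NormedAlgebra ℝ 𝔸] [NormedAddCommGroup V] [NormedSpace ℝ V]
  [Module 𝔸 V] {𝔤 : Submodule ℝ 𝔸}

/-- For a section `σ` of the evaluation `𝔤 → V` at `x`, the map `w ↦ exp (σ w) x`, corrected by the
linear term `w - (σ w) x`, which vanishes on the tangent space of the orbit of `x`, so as to have
invertible derivative at `0`. -/
noncomputable def slice (σ : V →ₗ[ℝ] 𝔤) (x w : V) : V :=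
  exp (σ w : 𝔸) • x + (w - (σ w : 𝔸) • x)

theorem slice_zero (σ : V →ₗ[ℝ] 𝔤) (x : V) : slice σ x 0 = x := by
  simp only [slice, map_zero, ZeroMemClass.coe_zero, exp_zero, one_smul, zero_smul, sub_zero,
    add_zero]

theorem slice_eq_expUnit_smul [CompleteSpace 𝔸] {σ : V →ₗ[ℝ] 𝔤} {x t : V} (ht : (σ t : 𝔸) • x = t) :
    slice σ x t = expUnit (σ t : 𝔸) • x := by
  rw [slice, ht, sub_self, add_zero]
  rfl

end Slice

section Orbit

variable {𝔸 V : Type*} [NormedRing 𝔸] [NormedAlgebra ℝ 𝔸] [FiniteDimensional ℝ 𝔸]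
  [NormedAddCommGroup V] [NormedSpace ℝ V] [Module 𝔸 V] [IsScalarTower ℝ 𝔸 V] {G : Subgroup 𝔸ˣ}
  {𝔤 : Submodule ℝ 𝔸}

/-- Evaluation `a ↦ a x` at a vector `x` of a module over a finite-dimensional algebra. -/
noncomputable def evalCLM (𝔸 : Type*) [NormedRing 𝔸] [NormedAlgebra ℝ 𝔸] [FiniteDimensional ℝ 𝔸]
    [Module 𝔸 V] [IsScalarTower ℝ 𝔸 V] (x : V) : 𝔸 →L[ℝ] V :=
  ((LinearMap.toSpanSingleton 𝔸 V x).restrictScalars ℝ).toContinuousLinearMap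

@[simp]
theorem evalCLM_apply (x : V) (a : 𝔸) : evalCLM 𝔸 x a = a • x := rfl

theorem exp_smul_eq_self_of_smul_eq_zero {a : 𝔸} {x : V} (h : a • x = 0) : exp a • x = x := by
  have hsum := (exp_series_hasSum_exp' (𝕂 := ℝ) a).mapL (evalCLM 𝔸 x)
  have hterm : ∀ k ≠ 0, evalCLM 𝔸 x ((k.factorial : ℝ)⁻¹ • a ^ k) = 0 := fun k hk => by
    obtain ⟨j, rfl⟩ := Nat.exists_eq_succ_of_ne_zero hk
    rw [map_smul, evalCLM_apply, pow_succ, mul_smul, h, smul_zero, smul_zero]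
  simpa using hsum.unique (hasSum_single 0 hterm)

theorem eventually_mem_imp_exists_expUnit_section_smul_eq (hG : IsClosed (G : Set 𝔸ˣ))
    (h𝔤 : lieAlgebra G = (𝔤 : Set 𝔸)) {x : V} {σ : V →ₗ[ℝ] 𝔤}
    (hσ : ∀ t ∈ tangentSpace 𝔤 x, (σ t : 𝔸) • x = t) {U : Set V} (hU : U ∈ 𝓝 0) :
    ∀ᶠ g in 𝓝 (1 : 𝔸ˣ), g ∈ G →
      ∃ t ∈ (tangentSpace 𝔤 x : Set V) ∩ U, expUnit (σ t : 𝔸) • x = g • x := by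
  let P : 𝔸 →ₗ[ℝ] 𝔸 := 𝔤.subtype ∘ₗ σ ∘ₗ evalCLM 𝔸 x
  have hevalU : evalCLM 𝔸 x ⁻¹' U ∈ 𝓝 0 :=
    (evalCLM 𝔸 x).continuous.tendsto' 0 0 (map_zero _) hU
  filter_upwards [eventually_mem_imp_exists_expUnit_mul_expUnit_eq hG h𝔤 (P := P)
    (fun a _ => (σ (a • x)).2) hevalU] with g hg hgG
  obtain ⟨a, ⟨ha, haU⟩, rfl⟩ := hg hgG
  have hax : a • x ∈ tangentSpace 𝔤 x := ⟨a, ha, rfl⟩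
  have hker : (a - P a) • x = 0 := by
    rw [sub_smul, sub_eq_zero]
    exact (hσ _ hax).symm
  have hfix : expUnit (a - P a) • x = x := exp_smul_eq_self_of_smul_eq_zero hker
  exact ⟨a • x, ⟨hax, haU⟩, by rw [mul_smul, hfix]; rfl⟩

theorem eventually_mem_orbit_imp_exists_expUnit_section_smul_eq (hG : IsCompact (G : Set 𝔸ˣ))
    (h𝔤 : lieAlgebra G = (𝔤 : Set 𝔸)) {x : V} {σ : V →ₗ[ℝ] 𝔤}
    (hσ : ∀ t ∈ tangentSpace 𝔤 x, (σ t : 𝔸) • x = t) {U : Set V} (hU : U ∈ 𝓝 0) :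
    ∀ᶠ y in 𝓝 x, y ∈ MulAction.orbit G x →
      ∃ t ∈ (tangentSpace 𝔤 x : Set V) ∩ U, expUnit (σ t : 𝔸) • x = y := by
  have : CompactSpace G := isCompact_iff_compactSpace.1 hG
  have orbitMap_continuous : Continuous fun g : G => g • x :=
    (evalCLM 𝔸 x).continuous.comp (Units.continuous_val.comp continuous_subtype_val)
  have near_one := continuous_subtype_val.tendsto' (1 : G) 1 rfl |>.eventually
    (eventually_mem_imp_exists_expUnit_section_smul_eq hG.isClosed h𝔤 hσ hU)
  filter_upwards [eventually_mem_orbit_imp_exists_smul_eq orbitMap_continuous near_one]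
    with y hy hyx
  obtain ⟨g, hg, rfl⟩ := hy hyx
  exact hg g.2

variable [FiniteDimensional ℝ V]

theorem contDiff_slice (σ : V →ₗ[ℝ] 𝔤) (x : V) : ContDiff ℝ ω (slice σ x) := by
  have hexp : ContDiff ℝ ω (exp : 𝔸 → 𝔸) :=
    contDiff_iff_contDiffAt.2 fun a => (exp_analytic (𝕂 := ℝ) a).contDiffAt
  have hσ : ContDiff ℝ ω fun w => (σ w : 𝔸) :=
    (LinearMap.toContinuousLinearMap (𝔤.subtype ∘ₗ σ)).contDiff
  have heval : ContDiff ℝ ω (evalCLM 𝔸 x) := (evalCLM 𝔸 x).contDiff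
  exact (heval.comp (hexp.comp hσ)).add (contDiff_id.sub (heval.comp hσ))

theorem hasFDerivAt_slice_zero (σ : V →ₗ[ℝ] 𝔤) (x : V) :
    HasFDerivAt (slice σ x) (ContinuousLinearMap.id ℝ V) 0 := by
  let s : V →L[ℝ] 𝔸 := LinearMap.toContinuousLinearMap (𝔤.subtype ∘ₗ σ)
  have hexp : HasFDerivAt (exp : 𝔸 → 𝔸) (1 : 𝔸 →L[ℝ] 𝔸) (s 0) := by
    rw [map_zero]
    exact hasFDerivAt_exp_zero
  have hslice := ((evalCLM 𝔸 x).hasFDerivAt.comp 0 (hexp.comp 0 s.hasFDerivAt)).add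
    ((hasFDerivAt_id (𝕜 := ℝ) (0 : V)).sub ((evalCLM 𝔸 x).hasFDerivAt.comp 0 s.hasFDerivAt))
  refine hslice.congr_fderiv ?_
  ext1 w
  exact add_sub_cancel (evalCLM 𝔸 x (s w)) w

theorem exists_chart_orbit (hG : IsCompact (G : Set 𝔸ˣ)) (h𝔤 : lieAlgebra G = (𝔤 : Set 𝔸))
    (x : V) :
    ∃ φ : OpenPartialHomeomorph V V, x ∈ φ.source ∧ ContDiffOn ℝ ω φ φ.source ∧
      ContDiffOn ℝ ω φ.symm φ.target ∧
      φ '' (φ.source ∩ MulAction.orbit G x) = φ.target ∩ (tangentSpace 𝔤 x : Set V) := by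
  obtain ⟨σ, hσ⟩ := exists_section_on_map ((LinearMap.toSpanSingleton 𝔸 V x).restrictScalars ℝ) 𝔤
  have slice_eq : ∀ t ∈ tangentSpace 𝔤 x, slice σ x t = expUnit (σ t : 𝔸) • x := fun t ht =>
    slice_eq_expUnit_smul (hσ t ht)
  have hchart := exists_flattening_chart (f' := .refl ℝ V) (T := (tangentSpace 𝔤 x : Set V))
    (S := MulAction.orbit G x) (by decide) (by decide) (contDiff_slice σ x)
    (hasFDerivAt_slice_zero σ x)
  rw [slice_zero] at hchart
  refine hchart (fun t ht => ?_) fun U hU => ?_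
  · rw [slice_eq t ht]
    exact ⟨⟨_, expUnit_mem (h𝔤.symm.subset (σ t).2)⟩, rfl⟩
  · filter_upwards [eventually_mem_orbit_imp_exists_expUnit_section_smul_eq hG h𝔤 hσ hU]
      with y hy hyx
    obtain ⟨t, ht, rfl⟩ := hy hyx
    exact ⟨t, ht, slice_eq t ht.1⟩

end Orbit

section LinearFields

theorem lieBracket_continuousLinearMap {𝕜 V : Type*} [NontriviallyNormedField 𝕜]
    [NormedAddCommGroup V] [NormedSpace 𝕜 V] (A C : V →L[𝕜] V) :
    VectorField.lieBracket 𝕜 A C = ⁅C, A⁆ := by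
  ext x
  simp only [VectorField.lieBracket_eq, ContinuousLinearMap.fderiv, Ring.lie_def]
  rfl

variable {n : ℕ}

theorem lieBracket_linearField (A C : Mat n) :
    VectorField.lieBracket ℝ (linearField A) (linearField C) = linearField ⁅C, A⁆ := by
  let L := Matrix.toEuclideanCLM (n := Fin n) (𝕜 := ℝ)
  change VectorField.lieBracket ℝ (L A) (L C) = L ⁅C, A⁆
  rw [lieBracket_continuousLinearMap, Ring.lie_def, Ring.lie_def, map_sub, map_mul, map_mul]

/-- The identification of matrices with linear vector fields, as a linear map. -/
noncomputable def linearFieldMap (n : ℕ) : Mat n →ₗ[ℝ] E n → E n :=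
  LinearMap.ltoFun ℝ (E n) (E n) ℝ ∘ₗ Matrix.toEuclideanLin.toLinearMap

@[simp]
theorem linearFieldMap_apply (A : Mat n) : linearFieldMap n A = linearField A := rfl

theorem subset_fieldLieSpan (F : Set (E n → E n)) : F ⊆ fieldLieSpan F := fun _ hV =>
  Submodule.mem_sInf.2 fun _ hL => hL.1 hV

theorem lieBracket_mem_fieldLieSpan {F : Set (E n → E n)} {V W : E n → E n}
    (hV : V ∈ fieldLieSpan F) (hW : W ∈ fieldLieSpan F) :
    VectorField.lieBracket ℝ V W ∈ fieldLieSpan F :=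
  Submodule.mem_sInf.2 fun L hL =>
    hL.2 V (Submodule.mem_sInf.1 hV L hL) W (Submodule.mem_sInf.1 hW L hL)

theorem fieldLieSpan_range_linearField {ι : Type*} (B : ι → Mat n) :
    fieldLieSpan (Set.range fun i => linearField (B i)) =
      (LieSubalgebra.lieSpan ℝ (Mat n) (Set.range B)).toSubmodule.map (linearFieldMap n) := by
  refine le_antisymm (sInf_le ⟨?_, ?_⟩) (Submodule.map_le_iff_le_comap.2 fun A hA => ?_)
  · rintro _ ⟨i, rfl⟩
    exact ⟨B i, LieSubalgebra.subset_lieSpan ⟨i, rfl⟩, rfl⟩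
  · rintro _ ⟨A, hA, rfl⟩ _ ⟨C, hC, rfl⟩
    exact ⟨⁅C, A⁆, LieSubalgebra.lie_mem _ hC hA, (lieBracket_linearField A C).symm⟩
  · rw [Submodule.mem_comap]
    induction hA using LieSubalgebra.lieSpan_induction with
    | mem A hA =>
      obtain ⟨i, rfl⟩ := hA
      exact subset_fieldLieSpan _ ⟨i, rfl⟩
    | zero => simp only [map_zero, zero_mem]
    | add A C _ _ hA hC => simpa only [map_add] using add_mem hA hC
    | smul c A _ hA => simpa only [map_smul] using Submodule.smul_mem _ c hA
    | lie A C _ _ hA hC =>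
      rw [linearFieldMap_apply, ← lieBracket_linearField]
      exact lieBracket_mem_fieldLieSpan hC hA

theorem fieldRankAt_fieldLieSpan_range_linearField {ι : Type*} (B : ι → Mat n) (y : E n) :
    fieldRankAt (fieldLieSpan (Set.range fun i => linearField (B i))) y =
      rankAt (LieSubalgebra.lieSpan ℝ (Mat n) (Set.range B)) y := by
  rw [fieldLieSpan_range_linearField, fieldRankAt, rankAt, ← Submodule.map_comp]
  rfl

end LinearFields

section Matrices

open scoped Matrix.Norms.Operator

theorem isCompact_unitaryGroup (ι 𝕜 : Type*) [Fintype ι] [DecidableEq ι] [RCLike 𝕜] :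
    IsCompact (Matrix.unitaryGroup ι 𝕜 : Set (Matrix ι ι 𝕜)) := by
  have entries_compact : IsCompact (Set.univ.pi fun _ : ι => Set.univ.pi fun _ : ι =>
      Metric.closedBall (0 : 𝕜) 1) :=
    isCompact_univ_pi fun _ => isCompact_univ_pi fun _ => isCompact_closedBall _ _
  refine entries_compact.of_isClosed_subset
    (isClosed_unitary (R := Matrix ι ι 𝕜)) fun U hU i _ j _ => ?_
  rw [mem_closedBall_zero_iff]
  exact entry_norm_bound_of_unitary hU i j

theorem isCompact_specialUnitaryGroup (ι 𝕜 : Type*) [Fintype ι] [DecidableEq ι] [RCLike 𝕜] :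
    IsCompact (Matrix.specialUnitaryGroup ι 𝕜 : Set (Matrix ι ι 𝕜)) :=
  (isCompact_unitaryGroup ι 𝕜).inter_right
    (isClosed_eq continuous_id.matrix_det continuous_const)

variable {n : ℕ}

variable {G : Subgroup (Mat n)ˣ} {𝔤 : LieSubalgebra ℝ (Mat n)}

theorem rankAt_eq_of_mem_orbit (h𝔤 : lieAlgebra G = (𝔤 : Set (Mat n))) {x y : E n}
    (hy : y ∈ MulAction.orbit G x) : rankAt 𝔤 y = rankAt 𝔤 x :=
  finrank_tangentSpace_eq_of_mem_orbit (𝔤 := 𝔤.toSubmodule) h𝔤 hy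

theorem isEmbeddedSubmanifold_orbit (hG : IsCompact (G : Set (Mat n)ˣ))
    (h𝔤 : lieAlgebra G = (𝔤 : Set (Mat n))) (x : E n) :
    IsEmbeddedSubmanifold (rankAt 𝔤 x) (MulAction.orbit G x) := by
  intro p hp
  obtain ⟨φ, hpφ, hφ, hφ_symm, himage⟩ := exists_chart_orbit (𝔤 := 𝔤.toSubmodule) hG h𝔤 p
  rw [MulAction.orbit_eq_iff.2 hp] at himage
  exact ⟨φ, tangentSpace 𝔤.toSubmodule p, hpφ, hφ.of_le le_top, hφ_symm.of_le le_top,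
    rankAt_eq_of_mem_orbit h𝔤 hp, himage⟩

/-- A subgroup of `SO(n)` as a group of invertible matrices. -/
def unitSubgroup (H : Subgroup (Matrix.specialOrthogonalGroup (Fin n) ℝ)) : Subgroup (Mat n)ˣ :=
  H.map (Matrix.specialOrthogonalGroup (Fin n) ℝ).subtype.toHomUnits

variable {H : Subgroup (Matrix.specialOrthogonalGroup (Fin n) ℝ)}

theorem isCompact_unitSubgroup
    (hH : IsClosed (H : Set (Matrix.specialOrthogonalGroup (Fin n) ℝ))) :
    IsCompact (unitSubgroup H : Set (Mat n)ˣ) := by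
  have : CompactSpace (Matrix.specialOrthogonalGroup (Fin n) ℝ) :=
    isCompact_iff_compactSpace.1 (isCompact_specialUnitaryGroup (Fin n) ℝ)
  refine hH.isCompact.image (Units.continuous_iff.2 ⟨continuous_subtype_val, ?_⟩)
  exact continuous_star.comp continuous_subtype_val

theorem exists_mem_unitSubgroup (p : Mat n → Prop) :
    (∃ g ∈ unitSubgroup H, p g) ↔ ∃ g ∈ H, p g :=
  Set.exists_mem_image

theorem lieAlgebra_unitSubgroup : lieAlgebra (unitSubgroup H) = lieAlgebraOf H :=
  Set.ext fun A => forall_congr' fun t => exists_mem_unitSubgroup (· = exp (t • A))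

theorem orbit_unitSubgroup (x : E n) : MulAction.orbit (unitSubgroup H) x = orbit H x := by
  ext y
  simp only [MulAction.mem_orbit_iff, Subtype.exists, Subgroup.mk_smul, exists_prop]
  exact exists_mem_unitSubgroup (Matrix.toEuclideanLin · x = y)

end Matrices

end OrbitRank

open OrbitRank in
theorem mainTheorem6_general {n : ℕ} {ι : Type*} (B : ι → Mat n) {G : Subgroup (Mat n)ˣ}
    (hG : IsCompact (G : Set (Mat n)ˣ))
    (hG_lie : lieAlgebra G = (LieSubalgebra.lieSpan ℝ (Mat n) (Set.range B) : Set (Mat n)))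
    (x : E n) :
    ∃ d : ℕ, IsEmbeddedSubmanifold d (MulAction.orbit G x) ∧
      (∀ y ∈ MulAction.orbit G x,
        rankAt (LieSubalgebra.lieSpan ℝ (Mat n) (Set.range B)) y = d) ∧
      (∀ y ∈ MulAction.orbit G x,
        fieldRankAt (fieldLieSpan (Set.range fun i => linearField (B i))) y = d) := by
  refine ⟨_, isEmbeddedSubmanifold_orbit hG hG_lie x,
    fun y hy => rankAt_eq_of_mem_orbit hG_lie hy, fun y hy => ?_⟩
  rw [fieldRankAt_fieldLieSpan_range_linearField]
  exact rankAt_eq_of_mem_orbit hG_lie hy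

theorem mainTheorem6 (n m : ℕ) (B : Fin (m + 1) → OrbitRank.Mat n)
    (hB : ∀ i, B i ∈ LieAlgebra.Orthogonal.so (Fin n) ℝ)
    (𝔥 : LieSubalgebra ℝ (OrbitRank.Mat n))
    (h𝔥 : 𝔥 = LieSubalgebra.lieSpan ℝ (OrbitRank.Mat n) (Set.range B))
    (H : Subgroup (Matrix.specialOrthogonalGroup (Fin n) ℝ))
    (hH_closed : IsClosed (H : Set (Matrix.specialOrthogonalGroup (Fin n) ℝ)))
    (hH_lie : OrbitRank.lieAlgebraOf H = (𝔥 : Set (OrbitRank.Mat n)))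
    (x : OrbitRank.E n) (hx : x ∈ Metric.sphere (0 : OrbitRank.E n) 1) :
    ∃ d : ℕ, OrbitRank.IsEmbeddedSubmanifold d (OrbitRank.orbit H x) ∧
      (∀ y ∈ OrbitRank.orbit H x, OrbitRank.rankAt 𝔥 y = d) ∧
      (∀ y ∈ OrbitRank.orbit H x,
        OrbitRank.fieldRankAt
          (OrbitRank.fieldLieSpan (Set.range fun i => OrbitRank.linearField (B i))) y = d) := by
  subst h𝔥
  simpa only [OrbitRank.orbit_unitSubgroup] using mainTheorem6_general B
    (OrbitRank.isCompact_unitSubgroup hH_closed) (OrbitRank.lieAlgebra_unitSubgroup.trans hH_lie) x
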